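/- There is a universal constant $C>0$ such that the following holds for all finite sets $X$ and $Y$ and every boolean function $f$ on $X\times Y$. Let $\mathrm{CC}^{\det}(f)$ be the deterministic communication complexity of $f$, that is, the minimum, over all deterministic two-party protocol trees computing $f$ (at each internal node one of the two players, of whom one knows only $x\in X$ and the other only $y\in Y$, sends one bit depending on their own input and on the bits sent so far; each leaf is labelled with the output), of the maximal number of bits sent. Let $r=\operatorname{rank}(f)$ be the rank over $\mathbb{R}$ of the $X\times Y$ matrix $M_f$ with entries $(M_f)_{x,y}=f(x,y)$, where the two values of $f$ are written either as $0,1$ or as $-1,1$ (the claim holds for each of the two conventions). If $r\ge 2$, then $$\mathrm{CC}^{\det}(f)\le C\cdot\sqrt{r}\cdot\log_2 r .$$ -/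

import Mathlib

namespace TwoParty

/-- A deterministic two-party protocol tree with inputs `x : X` (held by the row player)
and `y : Y` (held by the column player). At an internal node one of the players sends one bit,
which depends on that player's input and on the node (that is, on the bits sent so far); the
protocol continues in the first subtree if the bit is `true` and in the second one if it is
`false`. A leaf carries the output. -/
inductive Protocol (X : Type*) (Y : Type*) where
  | output (b : Bool) : Protocol X Y
  | rowSends (bit : X → Bool) (P₁ P₀ : Protocol X Y) : Protocol X Y
  | colSends (bit : Y → Bool) (P₁ P₀ : Protocol X Y) : Protocol X Y

namespace Protocol

variable {X : Type*} {Y : Type*}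

/-- The output of the protocol on the input `(x, y)`. -/
def run : Protocol X Y → X → Y → Bool
  | output b, _, _ => b
  | rowSends bit P₁ P₀, x, y => if bit x then P₁.run x y else P₀.run x y
  | colSends bit P₁ P₀, x, y => if bit y then P₁.run x y else P₀.run x y

/-- The cost of a protocol: the height of its tree, that is, the largest number of bits sent on
a path from the root to a leaf. -/
def cost : Protocol X Y → ℕ
  | output _ => 0
  | rowSends _ P₁ P₀ => max P₁.cost P₀.cost + 1
  | colSends _ P₁ P₀ => max P₁.cost P₀.cost + 1

/-- The protocol computes `f`. -/
def Computes (P : Protocol X Y) (f : X → Y → Bool) : Prop :=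
  ∀ x y, P.run x y = f x y

end Protocol

/-- The deterministic communication complexity of `f`: the least cost of a deterministic
protocol that computes `f`. -/
noncomputable def detCC {X : Type*} {Y : Type*} (f : X → Y → Bool) : ℕ :=
  sInf {c : ℕ | ∃ P : Protocol X Y, P.Computes f ∧ P.cost = c}

/-- If `X` is finite then the set in the definition of `detCC` is not empty. -/
theorem exists_computes {X : Type*} {Y : Type*} [Finite X] (f : X → Y → Bool) :
    ∃ P : Protocol X Y, P.Computes f := by
  classical
  have key : ∀ s : Finset X, ∃ P : Protocol X Y, ∀ x ∈ s, ∀ y, P.run x y = f x y := by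
    intro s
    induction s using Finset.induction_on with
    | empty => exact ⟨.output true, by simp⟩
    | insert a s ha ih =>
      obtain ⟨P, hP⟩ := ih
      refine ⟨.rowSends (fun x => decide (x = a))
        (.colSends (f a) (.output true) (.output false)) P, ?_⟩
      intro x hx y
      by_cases hxa : x = a
      · subst hxa
        cases h : f x y <;> simp [Protocol.run, h]
      · have hxs : x ∈ s := by simpa [hxa] using hx
        simp [Protocol.run, hxa, hP x hxs y]
  haveI := Fintype.ofFinite X
  obtain ⟨P, hP⟩ := key Finset.univ
  exact ⟨P, fun x y => hP x (Finset.mem_univ x) y⟩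

/-- If `X` is finite then the minimum in the definition of `detCC` is attained. -/
theorem exists_computes_cost_eq_detCC {X : Type*} {Y : Type*} [Finite X] (f : X → Y → Bool) :
    ∃ P : Protocol X Y, P.Computes f ∧ P.cost = detCC f := by
  obtain ⟨P, hP⟩ := exists_computes f
  exact Nat.sInf_mem (s := {c : ℕ | ∃ P : Protocol X Y, P.Computes f ∧ P.cost = c})
    ⟨P.cost, P, hP, rfl⟩

/-- The matrix of `f` with entries in `{0, 1}`, over the reals. -/
def zeroOneMatrix {X : Type*} {Y : Type*} (f : X → Y → Bool) : Matrix X Y ℝ :=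
  Matrix.of fun x y => if f x y then 1 else 0

/-- The matrix of `f` with entries in `{-1, 1}`, over the reals. -/
def signMatrix {X : Type*} {Y : Type*} (f : X → Y → Bool) : Matrix X Y ℝ :=
  Matrix.of fun x y => if f x y then 1 else -1

end TwoParty

/-!
The matrix `M` of `f` is taken with entries `±1`; passing to entries `0, 1` changes the rank by at
most one (`rank_signMatrix_le_rank_zeroOneMatrix_add_one`). The argument has three parts.

*Low rank gives short vectors.* A matrix of rank `r` with entries in `[-1, 1]` can be written as
`M x y = ⟪u x, v y⟫` with `‖u x‖ ≤ 1` and `‖v y‖ ≤ √r` (`exists_inner_eq_of_abs_le_one`). The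
Euclidean structure comes from a D-optimal design: if the rows of `V` are a basis of the row space
of `M`, it is a probability vector `p` on the columns that maximises `det (V * diagonal p * Vᵀ)`.
It plays the part of John's ellipsoid, and exists by compactness.

*Short vectors give large monochromatic rectangles.* For a standard Gaussian `g`, choose rows and
columns independently with probabilities `(1 + sin ⟪g, u x⟫) / 2` and `(1 + sin ⟪g, v y⟫) / 2`,
after scaling `v` by `1 / √r`. The expected correlation of the sines is
`exp (-(‖u‖² + ‖v‖²) / 2) * sinh ⟪u, v⟫`, so that entries `1` survive with probability at least
`1 / 4`, and entries `-1` with probability at most `(1 - c / √r) / 4`. After `O(√r log r)`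
independent rounds, if at least half of the entries of `M` are `1`, as may be assumed, some
rectangle of density `2 ^ (-O(√r log r))` has a fraction of at most `1 / (4 r)` entries `-1`. At
least half of its rows have few entries `-1`; these are spanned by `r` of them, which are all `1`
on half of the columns, and hence each is constant there
(`exists_monochromatic_of_card_false_le`).

*Large monochromatic rectangles give protocols* (Nisan and Wigderson). If `A × B` is monochromatic,
then the rows `A` or the columns `B` have rank at most `(r + 1) / 2`. Splitting these off again and
again exhausts the matrix after `2 ^ O(√r log r)` steps (`exists_peeling`), since it has at most
`2 ^ r` distinct rows and columns. Each player announces the step at which their own input is split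
off. This costs `O(√r log r)` bits and leaves a rectangle of rank at most `(r + 1) / 2`, and the
costs of the successive halvings form a geometric series (`exists_protocol_of_rectRank_le`).
-/

namespace TwoParty

open Matrix Module

/-! ### Ranks of submatrices -/

section LinearAlgebra

variable {m n : Type*}

/-- Rows of `M` that form a basis of its row space. -/
theorem exists_linearIndependent_rows [Finite m] [Fintype n] (M : Matrix m n ℝ) :
    ∃ b : Fin M.rank → m, LinearIndependent ℝ (fun i => M (b i)) ∧
      ∀ x, M x ∈ Submodule.span ℝ (Set.range fun i => M (b i)) := by
  have key : ∀ k, k = finrank ℝ (Submodule.span ℝ (Set.range M.row)) →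
      ∃ b : Fin k → m, LinearIndependent ℝ (fun i => M (b i)) ∧
        ∀ x, M x ∈ Submodule.span ℝ (Set.range fun i => M (b i)) := by
    rintro _ rfl
    obtain ⟨g, hg, hspan, hind⟩ := Submodule.exists_fun_fin_finrank_span_eq ℝ (Set.range M.row)
    choose b hb using hg
    have hgb : (fun i => M (b i)) = g := funext hb
    refine ⟨b, hgb ▸ hind, fun x => ?_⟩
    rw [hgb, hspan]
    exact Submodule.subset_span ⟨x, rfl⟩
  exact key _ M.rank_eq_finrank_span_row

/-- The step that halves the rank: the rows through a constant block and the columns through it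
cannot both have large rank. Restricting the row space to the columns of the block has rank the
rank of those columns, while the rows of the block are mapped to a line, so that they have rank
at most one more than the kernel. -/
theorem rank_submatrix_add_rank_submatrix_le {m₀ n₀ : Type*} [Finite m] [Finite m₀] [Fintype n]
    [Fintype n₀] (M : Matrix m n ℝ) (a : m₀ → m) (b : n₀ → n) (c : ℝ)
    (h : ∀ i j, M (a i) (b j) = c) :
    (M.submatrix a id).rank + (M.submatrix id b).rank ≤ M.rank + 1 := by
  let ρ : (n → ℝ) →ₗ[ℝ] (n₀ → ℝ) := LinearMap.funLeft ℝ ℝ b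
  let L := Submodule.span ℝ (Set.range M.row)
  let L' := Submodule.span ℝ (Set.range (M.submatrix a id).row)
  have hL'L : L' ≤ L := by
    refine Submodule.span_mono ?_
    rintro _ ⟨i, rfl⟩
    exact ⟨a i, rfl⟩
  have hmap : L.map ρ = Submodule.span ℝ (Set.range (M.submatrix id b).row) := by
    rw [Submodule.map_span, ← Set.range_comp]
    rfl
  have hmap' : L'.map ρ ≤ Submodule.span ℝ {fun _ => c} := by
    rw [Submodule.map_span, ← Set.range_comp, Submodule.span_le]
    rintro _ ⟨i, rfl⟩
    refine Submodule.subset_span ?_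
    ext j
    exact h i j
  have h1 := LinearMap.finrank_range_add_finrank_ker (ρ.domRestrict L)
  have h2 := LinearMap.finrank_range_add_finrank_ker (ρ.domRestrict L')
  rw [LinearMap.range_domRestrict] at h1 h2
  have h3 : finrank ℝ (L'.map ρ) ≤ 1 :=
    (Submodule.finrank_mono hmap').trans (by
      simpa using finrank_span_le_card (R := ℝ) ({fun _ => c} : Set (n₀ → ℝ)))
  have h4 : finrank ℝ (LinearMap.ker (ρ.domRestrict L')) ≤
      finrank ℝ (LinearMap.ker (ρ.domRestrict L)) := by
    let g : LinearMap.ker (ρ.domRestrict L') →ₗ[ℝ] LinearMap.ker (ρ.domRestrict L) :=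
      ((Submodule.inclusion hL'L).comp (Submodule.subtype _)).codRestrict _
        (fun z => z.2)
    refine LinearMap.finrank_le_finrank_of_injective (f := g) fun z w hzw => ?_
    have := congrArg (fun t : LinearMap.ker (ρ.domRestrict L) => ((t : L) : n → ℝ)) hzw
    exact Subtype.ext (Subtype.ext this)
  rw [rank_eq_finrank_span_row, rank_eq_finrank_span_row, rank_eq_finrank_span_row, ← hmap]
  change finrank ℝ L' + _ ≤ finrank ℝ L + 1
  omega

end LinearAlgebra

/-! ### Optimal designs and the factorization of a low-rank matrix -/

section Factorization

variable {k n : Type*} [Fintype k] [DecidableEq k] [Fintype n] [DecidableEq n]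

/-- Existence of a D-optimal design (Kiefer and Wolfowitz): for vectors spanning `ℝᵏ`, the columns
of `V`, a probability vector `p` maximising `det (V * diagonal p * Vᵀ)` has the property that all
columns of `V` have length at most `√k` for the form inverse to this matrix. -/
theorem exists_optimal_design [Nonempty n] (V : Matrix k n ℝ)
    (hV : LinearIndependent ℝ V.row) :
    ∃ p ∈ stdSimplex ℝ n, IsUnit (V * diagonal p * Vᵀ).det ∧
      ∀ y, V.col y ⬝ᵥ (V * diagonal p * Vᵀ)⁻¹ *ᵥ V.col y ≤ Fintype.card k := by
  let D : (n → ℝ) → ℝ := fun p => (V * diagonal p * Vᵀ).det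
  have hcont : Continuous D := by
    refine Continuous.matrix_det ?_
    fun_prop
  obtain ⟨p, hp, hmax⟩ := (isCompact_stdSimplex ℝ n).exists_isMaxOn
    ⟨_, single_mem_stdSimplex ℝ (Classical.arbitrary n)⟩ hcont.continuousOn
  -- the uniform design has positive determinant
  have hpos : 0 < D p := by
    have hcard : (0 : ℝ) < Fintype.card n := by exact_mod_cast Fintype.card_pos
    have hu : (fun _ => (Fintype.card n : ℝ)⁻¹) ∈ stdSimplex ℝ n := by
      refine ⟨fun _ => by positivity, ?_⟩
      simp [hcard.ne']
    refine lt_of_lt_of_le ?_ (hmax hu)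
    have hD : D (fun _ => (Fintype.card n : ℝ)⁻¹) =
        ((Fintype.card n : ℝ)⁻¹) ^ Fintype.card k * (V * Vᵀ).det := by
      have : diagonal (fun _ : n => (Fintype.card n : ℝ)⁻¹) =
          (Fintype.card n : ℝ)⁻¹ • (1 : Matrix n n ℝ) := by
        rw [smul_one_eq_diagonal]
      simp only [D, this, Matrix.mul_smul, Matrix.mul_one, Matrix.smul_mul, det_smul]
    rw [hD]
    have hrank : (V * Vᵀ).rank = Fintype.card k := by
      rw [rank_self_mul_transpose, hV.rank_matrix]
    have hne : (V * Vᵀ).det ≠ 0 := by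
      have : IsUnit (V * Vᵀ) := by
        rw [← Matrix.linearIndependent_rows_iff_isUnit,
          linearIndependent_iff_card_eq_finrank_span, Set.finrank, ← rank_eq_finrank_span_row,
          hrank]
      exact ((isUnit_iff_isUnit_det _).1 this).ne_zero
    have hnn : 0 ≤ (V * Vᵀ).det := by
      have := (posSemidef_self_mul_conjTranspose V).det_nonneg
      simpa using this
    have := lt_of_le_of_ne hnn hne.symm
    positivity
  refine ⟨p, hp, hpos.ne'.isUnit, fun y => ?_⟩
  set A := V * diagonal p * Vᵀ with hA
  have hAu : IsUnit A.det := hpos.ne'.isUnit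
  set s := V.col y ⬝ᵥ A⁻¹ *ᵥ V.col y with hs
  set d := Fintype.card k with hd
  have hentry : ∀ (q : n → ℝ) i j, (V * diagonal q * Vᵀ) i j = ∑ z, q z * V i z * V j z := by
    intro q i j
    rw [Matrix.mul_apply]
    refine Finset.sum_congr rfl fun z _ => ?_
    rw [mul_diagonal, transpose_apply]
    ring
  -- moving weight `t` to the column `y` multiplies the determinant by this factor
  have hstep : ∀ t : ℝ, 0 ≤ t → t < 1 → (1 - t) ^ d * (1 + t / (1 - t) * s) ≤ 1 := by
    intro t ht0 ht1
    have ht : (1 - t) ≠ 0 := by linarith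
    have hq : (1 - t) • p + t • Pi.single y 1 ∈ stdSimplex ℝ n :=
      convex_stdSimplex ℝ n hp (single_mem_stdSimplex ℝ y) (by linarith) ht0 (by ring)
    have hle : D ((1 - t) • p + t • Pi.single y 1) ≤ D p := hmax hq
    have hmat : V * diagonal ((1 - t) • p + t • Pi.single y 1) * Vᵀ =
        (1 - t) • (A + replicateCol Unit ((t / (1 - t)) • V.col y) *
          replicateRow Unit (V.col y)) := by
      ext i j
      rw [hentry, Matrix.smul_apply, Matrix.add_apply, hA, hentry]
      simp only [Matrix.mul_apply, Pi.add_apply, Pi.smul_apply, smul_eq_mul, replicateCol_apply,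
        replicateRow_apply, col_apply, Finset.univ_unique, Finset.sum_const,
        Finset.card_singleton, one_smul, mul_add, add_mul, Finset.sum_add_distrib, Finset.mul_sum]
      congr 1
      · exact Finset.sum_congr rfl fun z _ => by ring
      · rw [Finset.sum_eq_single y]
        · simp only [Pi.single_eq_same]
          field_simp
        · intro z _ hz
          simp [hz]
        · simp
    have hdet : D ((1 - t) • p + t • Pi.single y 1) =
        (1 - t) ^ d * (A.det * (1 + t / (1 - t) * s)) := by
      simp only [D, hmat, det_smul]
      rw [det_add_replicateCol_mul_replicateRow hAu]
      congr 2
      rw [det_unique (n := Unit), Matrix.add_apply, Matrix.one_apply_eq, Matrix.mul_assoc]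
      congr 1
      rw [hs, ← smul_eq_mul, ← dotProduct_smul, ← Matrix.mulVec_smul]
      simp only [Matrix.mul_apply, replicateRow_apply, replicateCol_apply, dotProduct, mulVec,
        Finset.mul_sum, Pi.smul_apply]
    rw [hdet] at hle
    have hDA : D p = A.det := rfl
    rw [hDA] at hle hpos
    have : A.det * ((1 - t) ^ d * (1 + t / (1 - t) * s)) ≤ A.det * 1 := by linarith
    exact le_of_mul_le_mul_left this hpos
  by_contra! hlt
  have hbern : ∀ t : ℝ, 0 ≤ t → t < 1 → (1 - d * t) * (1 + t * s) ≤ 1 := by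
    intro t ht0 ht1
    have h1 := hstep t ht0 ht1
    have h2 : 1 - d * t ≤ (1 - t) ^ d := by
      have := one_add_mul_le_pow (a := -t) (by linarith) d
      rw [← sub_eq_add_neg] at this
      linarith
    have hs0 : 0 ≤ s := le_trans (by positivity) hlt.le
    have h3 : t ≤ t / (1 - t) := by
      rw [le_div_iff₀ (by linarith)]
      nlinarith
    have h4 : 1 + t * s ≤ 1 + t / (1 - t) * s := by
      have := mul_le_mul_of_nonneg_right h3 hs0
      linarith
    calc (1 - d * t) * (1 + t * s) ≤ (1 - t) ^ d * (1 + t * s) := by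
          have : 0 ≤ 1 + t * s := by positivity
          exact mul_le_mul_of_nonneg_right h2 this
      _ ≤ (1 - t) ^ d * (1 + t / (1 - t) * s) := by
          have : 0 ≤ (1 - t) ^ d := pow_nonneg (by linarith) _
          exact mul_le_mul_of_nonneg_left h4 this
      _ ≤ 1 := h1
  have hs0 : (0 : ℝ) < s := lt_of_le_of_lt (by positivity) hlt
  have hd0 : (0 : ℝ) ≤ d := by positivity
  -- for small `t` the term linear in `t` dominates
  have ht := hbern ((s - d) / (2 * (d * s + s))) (by
      have : 0 < s - d := by linarith
      positivity) (by
      rw [div_lt_one (by positivity)]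
      nlinarith [mul_nonneg hd0 hs0.le])
  set t := (s - d) / (2 * (d * s + s)) with htdef
  have htpos : 0 < t := by
    have : 0 < s - d := by linarith
    positivity
  have h5 : t * (2 * (d * s + s)) = s - d := by
    rw [htdef]
    field_simp
  have h6 : t * ((s - d) - t * (d * s)) ≤ 0 := by nlinarith
  have h7 : 0 < (s - d) - t * (d * s) := by
    rw [← h5]
    have : 0 < t * (d * s + 2 * s) := by positivity
    nlinarith
  nlinarith [mul_pos htpos h7]

end Factorization

/-- A matrix of rank `r` with entries in `[-1, 1]` has `γ₂`-norm at most `√r`. -/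
theorem exists_inner_eq_of_abs_le_one {m n : Type*} [Finite m] [Fintype n] [Nonempty n]
    (M : Matrix m n ℝ) (hM : ∀ x y, |M x y| ≤ 1) :
    ∃ (u : m → EuclideanSpace ℝ n) (v : n → EuclideanSpace ℝ n),
      (∀ x y, inner ℝ (u x) (v y) = M x y) ∧ (∀ x, ‖u x‖ ^ 2 ≤ 1) ∧
        ∀ y, ‖v y‖ ^ 2 ≤ M.rank := by
  classical
  obtain ⟨b, hb, hspan⟩ := exists_linearIndependent_rows M
  let V : Matrix (Fin M.rank) n ℝ := fun i => M (b i)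
  obtain ⟨p, hp, hu, hle⟩ := exists_optimal_design V hb
  have hU : ∀ x, ∃ c : Fin M.rank → ℝ, c ᵥ* V = M x := by
    intro x
    obtain ⟨c, hc⟩ := (Submodule.mem_span_range_iff_exists_fun ℝ).1 (hspan x)
    refine ⟨c, ?_⟩
    rw [← hc]
    ext y
    simp [vecMul, dotProduct, V]
  choose U hU using hU
  set A := V * diagonal p * Vᵀ with hA
  let w : n → n → ℝ := fun y => Vᵀ *ᵥ (A⁻¹ *ᵥ V.col y)
  have hsq : ∀ z, √(p z) * √(p z) = p z := fun z => Real.mul_self_sqrt (hp.1 z)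
  have hVw : ∀ y, V *ᵥ (diagonal p *ᵥ w y) = V.col y := by
    intro y
    rw [Matrix.mulVec_mulVec, Matrix.mulVec_mulVec, Matrix.mulVec_mulVec, ← hA,
      Matrix.mul_nonsing_inv _ hu, Matrix.one_mulVec]
  refine ⟨fun x => WithLp.toLp 2 fun z => √(p z) * M x z,
    fun y => WithLp.toLp 2 fun z => √(p z) * w y z, fun x y => ?_, fun x => ?_, fun y => ?_⟩
  · have h1 : inner ℝ (WithLp.toLp 2 fun z => √(p z) * M x z : EuclideanSpace ℝ n)
        (WithLp.toLp 2 fun z => √(p z) * w y z) = M x ⬝ᵥ (diagonal p *ᵥ w y) := by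
      simp only [PiLp.inner_apply, dotProduct, mulVec_diagonal]
      refine Finset.sum_congr rfl fun z _ => ?_
      simp only [RCLike.inner_apply, conj_trivial]
      linear_combination M x z * w y z * hsq z
    rw [h1, ← hU x, ← Matrix.dotProduct_mulVec, hVw]
    rfl
  · rw [EuclideanSpace.real_norm_sq_eq]
    calc ∑ z, (√(p z) * M x z) ^ 2 ≤ ∑ z, p z := by
          refine Finset.sum_le_sum fun z _ => ?_
          have h1 : (M x z) ^ 2 ≤ 1 := (sq_le_one_iff_abs_le_one _).2 (hM x z)
          rw [mul_pow, sq, hsq z]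
          exact mul_le_of_le_one_right (hp.1 z) h1
      _ = 1 := hp.2
  · rw [EuclideanSpace.real_norm_sq_eq]
    have h1 : ∑ z, (√(p z) * w y z) ^ 2 = w y ⬝ᵥ (diagonal p *ᵥ w y) := by
      simp only [dotProduct, mulVec_diagonal]
      refine Finset.sum_congr rfl fun z _ => ?_
      linear_combination (w y z) ^ 2 * hsq z
    have h2 : w y ⬝ᵥ (diagonal p *ᵥ w y) = V.col y ⬝ᵥ A⁻¹ *ᵥ V.col y := by
      conv_lhs => rw [show w y = (A⁻¹ *ᵥ V.col y) ᵥ* V from Matrix.mulVec_transpose _ _]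
      rw [← Matrix.dotProduct_mulVec, show (A⁻¹ *ᵥ V.col y) ᵥ* V = w y from
        (Matrix.mulVec_transpose _ _).symm, hVw, dotProduct_comm]
    change ∑ z, (√(p z) * w y z) ^ 2 ≤ _
    rw [h1, h2]
    simpa using hle y

/-! ### Kernels dominated by rectangles -/

section Rounding

variable {X Y : Type*} [Fintype X] [Fintype Y]

/-- The kernel `K` is dominated by rectangles: for every weight `W`, some combinatorial rectangle
`S × T` has total weight at least `∑ W * K`. By duality this says that `K` lies below a convex
combination of indicators of rectangles; the dual form is the one in which products of kernels
are easy. -/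
def IsRectAverage (K : X → Y → ℝ) : Prop :=
  ∀ W : X → Y → ℝ, ∃ (S : Finset X) (T : Finset Y),
    ∑ x, ∑ y, W x y * K x y ≤ ∑ x ∈ S, ∑ y ∈ T, W x y

theorem IsRectAverage.one : IsRectAverage (fun (_ : X) (_ : Y) => (1 : ℝ)) := fun W =>
  ⟨Finset.univ, Finset.univ, by simp⟩

theorem IsRectAverage.mul {K L : X → Y → ℝ} (hK : IsRectAverage K) (hL : IsRectAverage L) :
    IsRectAverage fun x y => K x y * L x y := by
  classical
  intro W
  obtain ⟨S, T, hST⟩ := hK fun x y => W x y * L x y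
  obtain ⟨S', T', hST'⟩ := hL fun x y => if x ∈ S then (if y ∈ T then W x y else 0) else 0
  refine ⟨S' ∩ S, T' ∩ T, ?_⟩
  calc ∑ x, ∑ y, W x y * (K x y * L x y) = ∑ x, ∑ y, W x y * L x y * K x y :=
        Finset.sum_congr rfl fun x _ => Finset.sum_congr rfl fun y _ => by ring
    _ ≤ _ := hST
    _ = ∑ x, ∑ y, (if x ∈ S then (if y ∈ T then W x y else 0) else 0) * L x y := by
        simp [ite_mul, Finset.sum_ite_mem]
    _ ≤ _ := hST'
    _ = _ := by
        rw [← Finset.sum_filter_add_sum_filter_not S' (· ∈ S)]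
        rw [Finset.filter_mem_eq_inter, Finset.sum_eq_zero (s := S'.filter (· ∉ S)), add_zero]
        · refine Finset.sum_congr rfl fun x hx => ?_
          simp [(Finset.mem_inter.1 hx).2, Finset.sum_ite_mem]
        · intro x hx
          simp [(Finset.mem_filter.1 hx).2]

theorem IsRectAverage.pow {K : X → Y → ℝ} (hK : IsRectAverage K) (N : ℕ) :
    IsRectAverage fun x y => K x y ^ N := by
  induction N with
  | zero => simpa using IsRectAverage.one
  | succ N ih => simpa only [pow_succ] using ih.mul hK

theorem sum_mul_le_sum_nonneg (w c : X → ℝ) (hc : ∀ x, c x ∈ Set.Icc (0 : ℝ) 1) :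
    ∑ x, c x * w x ≤ ∑ x with 0 ≤ w x, w x := by
  rw [Finset.sum_filter]
  refine Finset.sum_le_sum fun x _ => ?_
  split_ifs with h
  · exact mul_le_of_le_one_left h (hc x).2
  · exact mul_nonpos_of_nonneg_of_nonpos (hc x).1 (not_le.1 h).le

/-- A bilinear form on a product of cubes takes its maximum at a vertex. -/
theorem exists_rect_ge_of_mem_Icc (W : X → Y → ℝ) (a : X → ℝ) (b : Y → ℝ)
    (ha : ∀ x, a x ∈ Set.Icc (0 : ℝ) 1) (hb : ∀ y, b y ∈ Set.Icc (0 : ℝ) 1) :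
    ∃ (S : Finset X) (T : Finset Y),
      ∑ x, ∑ y, W x y * (a x * b y) ≤ ∑ x ∈ S, ∑ y ∈ T, W x y := by
  classical
  let S : Finset X := {x | 0 ≤ ∑ y, W x y * b y}
  refine ⟨S, ({y | 0 ≤ ∑ x ∈ S, W x y} : Finset Y), ?_⟩
  calc ∑ x, ∑ y, W x y * (a x * b y) = ∑ x, a x * ∑ y, W x y * b y := by
        refine Finset.sum_congr rfl fun x _ => ?_
        rw [Finset.mul_sum]
        exact Finset.sum_congr rfl fun y _ => by ring
    _ ≤ ∑ x ∈ S, ∑ y, W x y * b y := sum_mul_le_sum_nonneg _ _ ha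
    _ = ∑ y, b y * ∑ x ∈ S, W x y := by
        rw [Finset.sum_comm]
        refine Finset.sum_congr rfl fun y _ => ?_
        rw [Finset.mul_sum]
        exact Finset.sum_congr rfl fun x _ => by ring
    _ ≤ _ := sum_mul_le_sum_nonneg _ _ hb
    _ = _ := Finset.sum_comm

end Rounding

/-! ### Gaussian rounding -/

section Gaussian

open MeasureTheory ProbabilityTheory

variable {E : Type*} [NormedAddCommGroup E] [InnerProductSpace ℝ E] [FiniteDimensional ℝ E]
  [MeasurableSpace E] [BorelSpace E]

theorem integrable_comp_inner_stdGaussian {φ : ℝ → ℝ} (hφ : Continuous φ) {c : ℝ}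
    (hc : ∀ t, |φ t| ≤ c) (w : E) :
    Integrable (fun g => φ (inner ℝ g w)) (stdGaussian E) := by
  refine Integrable.of_bound (C := c) ?_ (ae_of_all _ fun g => hc _)
  exact (hφ.comp (by fun_prop)).aestronglyMeasurable

theorem integral_exp_inner_stdGaussian (w : E) :
    ∫ g, Complex.exp (inner ℝ g w * Complex.I) ∂stdGaussian E = (Real.exp (-‖w‖ ^ 2 / 2) : ℝ) := by
  rw [← charFun_apply, charFun_stdGaussian]
  push_cast
  rfl

theorem integrable_exp_inner_stdGaussian (w : E) :
    Integrable (fun g => Complex.exp (inner ℝ g w * Complex.I)) (stdGaussian E) := by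
  refine Integrable.of_bound (C := 1) ?_ (ae_of_all _ fun g => ?_)
  · exact Continuous.aestronglyMeasurable (by fun_prop)
  · rw [Complex.norm_exp_ofReal_mul_I]

theorem integral_cos_inner_stdGaussian (w : E) :
    ∫ g, Real.cos (inner ℝ g w) ∂stdGaussian E = Real.exp (-‖w‖ ^ 2 / 2) := by
  have h := congrArg Complex.re (integral_exp_inner_stdGaussian w)
  rw [Complex.ofReal_re] at h
  rw [← h]
  have := integral_re (𝕜 := ℂ) (integrable_exp_inner_stdGaussian w)
  simp only [RCLike.re_to_complex, Complex.exp_ofReal_mul_I_re] at this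
  exact this

theorem integral_sin_inner_stdGaussian (w : E) :
    ∫ g, Real.sin (inner ℝ g w) ∂stdGaussian E = 0 := by
  have h := congrArg Complex.im (integral_exp_inner_stdGaussian w)
  rw [Complex.ofReal_im] at h
  rw [← h]
  have := integral_im (𝕜 := ℂ) (integrable_exp_inner_stdGaussian w)
  simp only [RCLike.im_to_complex, Complex.exp_ofReal_mul_I_im] at this
  exact this

theorem integral_sin_mul_sin_stdGaussian (u v : E) :
    ∫ g, Real.sin (inner ℝ g u) * Real.sin (inner ℝ g v) ∂stdGaussian E =
      Real.exp (-(‖u‖ ^ 2 + ‖v‖ ^ 2) / 2) * Real.sinh (inner ℝ u v) := by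
  have h : ∀ g : E, Real.sin (inner ℝ g u) * Real.sin (inner ℝ g v) =
      2⁻¹ * (Real.cos (inner ℝ g (u - v)) - Real.cos (inner ℝ g (u + v))) := by
    intro g
    rw [inner_sub_right, inner_add_right, Real.cos_sub, Real.cos_add]
    ring
  have hcos : ∀ t, |Real.cos t| ≤ 1 := Real.abs_cos_le_one
  simp_rw [h]
  rw [integral_const_mul, integral_sub
    (integrable_comp_inner_stdGaussian Real.continuous_cos hcos _)
    (integrable_comp_inner_stdGaussian Real.continuous_cos hcos _),
    integral_cos_inner_stdGaussian, integral_cos_inner_stdGaussian, norm_sub_sq_real,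
    norm_add_sq_real, Real.sinh_eq, mul_div_assoc', mul_sub, mul_sub, ← Real.exp_add,
    ← Real.exp_add]
  ring_nf

/-- Rounding with a random Gaussian `g`: a row `x` is taken with probability
`(1 + sin ⟪g, u x⟫) / 2` and a column `y` with probability `(1 + sin ⟪g, v y⟫) / 2`. The sine,
unlike the sign, makes the correlation explicit, with the sign of `⟪u x, v y⟫`. -/
theorem isRectAverage_sinh {X Y : Type*} [Fintype X] [Fintype Y] (u : X → E) (v : Y → E) :
    IsRectAverage fun x y =>
      (1 + Real.exp (-(‖u x‖ ^ 2 + ‖v y‖ ^ 2) / 2) * Real.sinh (inner ℝ (u x) (v y))) / 4 := by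
  intro W
  let F : E → E → ℝ := fun w g => (1 + Real.sin (inner ℝ g w)) / 2
  have hF : ∀ w g, F w g ∈ Set.Icc (0 : ℝ) 1 := fun w g => by
    have := Real.neg_one_le_sin (inner ℝ g w)
    have := Real.sin_le_one (inner ℝ g w)
    constructor <;> simp only [F] <;> linarith
  have hsin : ∀ t, |Real.sin t| ≤ 1 := Real.abs_sin_le_one
  have hFF : ∀ a b : E, Integrable (fun g => F a g * F b g) (stdGaussian E) ∧
      ∫ g, F a g * F b g ∂stdGaussian E =
        (1 + Real.exp (-(‖a‖ ^ 2 + ‖b‖ ^ 2) / 2) * Real.sinh (inner ℝ a b)) / 4 := by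
    intro a b
    have ia := integrable_comp_inner_stdGaussian Real.continuous_sin hsin a
    have ib := integrable_comp_inner_stdGaussian Real.continuous_sin hsin b
    have iab : Integrable (fun g => Real.sin (inner ℝ g a) * Real.sin (inner ℝ g b))
        (stdGaussian E) := by
      refine Integrable.of_bound (C := 1) ?_ (ae_of_all _ fun g => ?_)
      · exact Continuous.aestronglyMeasurable (by fun_prop)
      · rw [Real.norm_eq_abs, abs_mul]
        exact mul_le_one₀ (hsin _) (abs_nonneg _) (hsin _)
    have ione : Integrable (fun _ : E => (1 : ℝ)) (stdGaussian E) := integrable_const _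
    have heq : (fun g => F a g * F b g) = fun g => (((1 + Real.sin (inner ℝ g a)) +
        Real.sin (inner ℝ g b)) + Real.sin (inner ℝ g a) * Real.sin (inner ℝ g b)) / 4 := by
      ext g
      simp only [F]
      ring
    rw [heq]
    refine ⟨(((ione.add ia).add ib).add iab).div_const 4, ?_⟩
    have i1 : Integrable (fun g => 1 + Real.sin (inner ℝ g a)) (stdGaussian E) := ione.add ia
    have i2 : Integrable (fun g => 1 + Real.sin (inner ℝ g a) + Real.sin (inner ℝ g b))
      (stdGaussian E) := i1.add ib
    rw [integral_div, integral_add i2 iab, integral_add i1 ib,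
      integral_add ione ia, integral_sin_inner_stdGaussian, integral_sin_inner_stdGaussian,
      integral_sin_mul_sin_stdGaussian]
    simp
  have hint : Integrable (fun g => ∑ x, ∑ y, W x y * (F (u x) g * F (v y) g)) (stdGaussian E) :=
    integrable_finsetSum _ fun x _ => integrable_finsetSum _ fun y _ =>
      (hFF (u x) (v y)).1.const_mul _
  obtain ⟨g, hg⟩ := exists_integral_le hint
  obtain ⟨S, T, hST⟩ := exists_rect_ge_of_mem_Icc W (fun x => F (u x) g) (fun y => F (v y) g)
    (fun x => hF _ _) (fun y => hF _ _)
  refine ⟨S, T, le_trans (le_of_eq ?_) (hg.trans hST)⟩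
  rw [integral_finsetSum _ fun x _ => integrable_finsetSum _ fun y _ =>
      (hFF (u x) (v y)).1.const_mul _]
  refine Finset.sum_congr rfl fun x _ => ?_
  rw [integral_finsetSum _ fun y _ => (hFF (u x) (v y)).1.const_mul _]
  refine Finset.sum_congr rfl fun y _ => ?_
  rw [integral_const_mul, (hFF (u x) (v y)).2]

end Gaussian

/-! ### Monochromatic rectangles -/

section MonochromaticRectangle

variable {X Y : Type*}

theorem signMatrix_apply (f : X → Y → Bool) (x : X) (y : Y) :
    signMatrix f x y = if f x y then 1 else -1 := rfl

theorem signMatrix_eq_iff {f : X → Y → Bool} {x x' : X} {y y' : Y} :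
    signMatrix f x y = signMatrix f x' y' ↔ f x y = f x' y' := by
  rw [signMatrix_apply, signMatrix_apply]
  cases f x y <;> cases f x' y' <;> norm_num

theorem abs_signMatrix_le_one (f : X → Y → Bool) (x : X) (y : Y) :
    |signMatrix f x y| ≤ 1 := by
  rw [signMatrix_apply]
  split_ifs <;> norm_num

theorem signMatrix_not (f : X → Y → Bool) :
    signMatrix (fun x y => !f x y) = -signMatrix f := by
  ext x y
  rw [neg_apply, signMatrix_apply, signMatrix_apply]
  cases f x y <;> norm_num

variable [Fintype X] [Fintype Y]

theorem rank_signMatrix_not (f : X → Y → Bool) :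
    (signMatrix fun x y => !f x y).rank ≤ (signMatrix f).rank := by
  classical
  rw [signMatrix_not, ← Matrix.one_mul (signMatrix f), ← Matrix.neg_mul, Matrix.one_mul]
  exact rank_mul_le_right _ _

/-- In low rank, a rectangle with few exceptional entries contains a large monochromatic one.
Discard the rows with many exceptions; on the columns where each of at most `r` rows
spanning the remaining ones has no exception, every remaining row is constant. -/
theorem exists_monochromatic_of_card_false_le (f : X → Y → Bool) {r : ℕ} (hr : 1 ≤ r)
    (hrank : (signMatrix f).rank ≤ r) (S : Finset X) (T : Finset Y) (hT : T.Nonempty)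
    (h : 4 * r * ((S ×ˢ T).filter fun p => f p.1 p.2 = false).card ≤ S.card * T.card) :
    ∃ (A : Finset X) (B : Finset Y) (c : Bool), (∀ x ∈ A, ∀ y ∈ B, f x y = c) ∧
      S.card * T.card ≤ 8 * (A.card * B.card) := by
  classical
  let m : X → ℕ := fun x => (T.filter fun y => f x y = false).card
  have hsum : ((S ×ˢ T).filter fun p => f p.1 p.2 = false).card = ∑ x ∈ S, m x := by
    simp only [m, Finset.card_filter, Finset.sum_product]
  rw [hsum] at h
  have hTpos : 0 < T.card := hT.card_pos
  let S' := S.filter fun x => 2 * r * m x ≤ T.card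
  have hS' : S.card ≤ 2 * S'.card := by
    have h1 : (S.filter fun x => ¬ 2 * r * m x ≤ T.card).card * T.card ≤
        2 * r * ∑ x ∈ S, m x := by
      rw [Finset.mul_sum, ← smul_eq_mul]
      refine le_trans (Finset.card_nsmul_le_sum _ (fun x => 2 * r * m x) _ fun x hx => ?_)
        (Finset.sum_le_sum_of_subset (Finset.filter_subset _ _))
      exact (not_le.1 (Finset.mem_filter.1 hx).2).le
    have h2 := Finset.card_filter_add_card_filter_not (s := S) fun x => 2 * r * m x ≤ T.card
    have h3 : 2 * (S.filter fun x => ¬ 2 * r * m x ≤ T.card).card ≤ S.card := by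
      refine Nat.le_of_mul_le_mul_right ?_ hTpos
      calc _ = 2 * ((S.filter fun x => ¬ 2 * r * m x ≤ T.card).card * T.card) := by ring
        _ ≤ 2 * (2 * r * ∑ x ∈ S, m x) := by gcongr
        _ = 4 * r * ∑ x ∈ S, m x := by ring
        _ ≤ _ := h
    change S.card ≤ 2 * (S.filter fun x => 2 * r * m x ≤ T.card).card
    omega
  obtain ⟨b, -, hspan⟩ := exists_linearIndependent_rows
    ((signMatrix f).submatrix (fun x : S' => x.1) id)
  have hk := (rank_submatrix_le (signMatrix f) (fun x : S' => x.1) id).trans hrank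
  let T' := T.filter fun y => ∀ i, f (b i).1 y = true
  have hT' : T.card ≤ 2 * T'.card := by
    have h1 : (T.filter fun y => ¬ ∀ i, f (b i).1 y = true).card ≤ ∑ i, m (b i) := by
      refine le_trans (Finset.card_le_card ?_) Finset.card_biUnion_le
      intro y hy
      obtain ⟨hyT, hy⟩ := Finset.mem_filter.1 hy
      push Not at hy
      obtain ⟨i, hi⟩ := hy
      exact Finset.mem_biUnion.2 ⟨i, Finset.mem_univ _,
        Finset.mem_filter.2 ⟨hyT, by simpa using hi⟩⟩
    have h2 : 2 * r * ∑ i, m (b i) ≤ r * T.card := by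
      rw [Finset.mul_sum]
      refine (Finset.sum_le_card_nsmul _ _ T.card fun i _ => ?_).trans ?_
      · exact (Finset.mem_filter.1 (b i).2).2
      · rw [Finset.card_univ, Fintype.card_fin, smul_eq_mul]
        gcongr
    have h3 : 2 * (T.filter fun y => ¬ ∀ i, f (b i).1 y = true).card ≤ T.card := by
      refine Nat.le_of_mul_le_mul_left ?_ hr
      calc _ = 2 * r * (T.filter fun y => ¬ ∀ i, f (b i).1 y = true).card := by ring
        _ ≤ 2 * r * ∑ i, m (b i) := by gcongr
        _ ≤ _ := h2
    have h4 := Finset.card_filter_add_card_filter_not (s := T) fun y => ∀ i, f (b i).1 y = true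
    change T.card ≤ 2 * (T.filter fun y => ∀ i, f (b i).1 y = true).card
    omega
  obtain ⟨y₀, hy₀⟩ : T'.Nonempty := Finset.card_pos.1 (by omega)
  have hconst : ∀ x ∈ S', ∀ y ∈ T', f x y = f x y₀ := by
    intro x hx y hy
    let φ : (Y → ℝ) →ₗ[ℝ] ℝ :=
      LinearMap.proj (R := ℝ) (φ := fun _ => ℝ) y - LinearMap.proj (R := ℝ) (φ := fun _ => ℝ) y₀
    have hle : Submodule.span ℝ (Set.range fun i =>
        (signMatrix f).submatrix (fun x : S' => x.1) id (b i)) ≤ LinearMap.ker φ := by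
      rw [Submodule.span_le]
      rintro _ ⟨i, rfl⟩
      have h1 := (Finset.mem_filter.1 hy).2 i
      have h2 := (Finset.mem_filter.1 hy₀).2 i
      simp [φ, signMatrix_apply, h1, h2]
    have h0 := hle (hspan ⟨x, hx⟩)
    have h1 : signMatrix f x y = signMatrix f x y₀ := sub_eq_zero.1 h0
    exact signMatrix_eq_iff.1 h1
  obtain ⟨c, hc⟩ : ∃ c : Bool, S'.card ≤ 2 * (S'.filter fun x => f x y₀ = c).card := by
    have h1 := Finset.card_filter_add_card_filter_not (s := S') fun x => f x y₀ = true
    simp only [Bool.not_eq_true] at h1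
    by_cases h2 : S'.card ≤ 2 * (S'.filter fun x => f x y₀ = true).card
    · exact ⟨true, h2⟩
    · exact ⟨false, by omega⟩
  refine ⟨S'.filter fun x => f x y₀ = c, T', c, fun x hx y hy => ?_, ?_⟩
  · obtain ⟨hxS, hxc⟩ := Finset.mem_filter.1 hx
    rw [hconst x hxS y hy, hxc]
  · calc S.card * T.card ≤ (2 * S'.card) * (2 * T'.card) := Nat.mul_le_mul hS' hT'
      _ ≤ (2 * (2 * (S'.filter fun x => f x y₀ = c).card)) * (2 * T'.card) := by gcongr
      _ = _ := by ring

/-- The kernel obtained by rounding the vectors of a factorization of the sign matrix: compared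
with the constant `1 / 4`, it favours the entries `1` over the entries `-1` by a factor
`1 + Ω(1 / √r)`. -/
theorem exists_isRectAverage_of_rank_le (f : X → Y → Bool) [Nonempty Y] {r : ℕ} (hr : 1 ≤ r)
    (hrank : (signMatrix f).rank ≤ r) :
    ∃ K : X → Y → ℝ, IsRectAverage K ∧ (∀ x y, 0 ≤ K x y) ∧
      (∀ x y, f x y = true → 1 / 4 ≤ K x y) ∧
      ∀ x y, f x y = false → K x y ≤ Real.exp (-(Real.exp (-1) / √r)) / 4 := by
  obtain ⟨u, v, huv, hu, hv⟩ :=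
    exists_inner_eq_of_abs_le_one (signMatrix f) (abs_signMatrix_le_one f)
  have hr' : (0 : ℝ) < r := by exact_mod_cast hr
  have hsq : (0 : ℝ) < √r := Real.sqrt_pos.2 hr'
  let w : Y → EuclideanSpace ℝ Y := fun y => (√r)⁻¹ • v y
  have hw : ∀ y, ‖w y‖ ^ 2 ≤ 1 := by
    intro y
    rw [norm_smul, mul_pow, Real.norm_eq_abs, sq_abs, inv_pow, Real.sq_sqrt hr'.le,
      inv_mul_le_one₀ hr']
    exact (hv y).trans (by exact_mod_cast hrank)
  have huw : ∀ x y, inner ℝ (u x) (w y) = (√r)⁻¹ * signMatrix f x y := by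
    intro x y
    rw [real_inner_smul_right, huv]
  have hδ : ∀ x y, Real.exp (-1) ≤ Real.exp (-(‖u x‖ ^ 2 + ‖w y‖ ^ 2) / 2) := by
    intro x y
    refine Real.exp_le_exp.2 ?_
    linarith [hu x, hw y]
  have hself : (√r)⁻¹ ≤ Real.sinh (√r)⁻¹ := Real.self_le_sinh_iff.2 (by positivity)
  refine ⟨_, isRectAverage_sinh u w, fun x y => ?_, fun x y hf => ?_, fun x y hf => ?_⟩
  · have h1 : -Real.sinh (inner ℝ (u x) (w y)) ≤
        Real.exp ((‖u x‖ ^ 2 + ‖w y‖ ^ 2) / 2) := by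
      rw [← Real.sinh_neg, ← inner_neg_left]
      have h2 : inner ℝ (-u x) (w y) ≤ (‖u x‖ ^ 2 + ‖w y‖ ^ 2) / 2 := by
        have := real_inner_le_norm (-u x) (w y)
        rw [norm_neg] at this
        nlinarith [sq_nonneg (‖u x‖ - ‖w y‖)]
      have h3 := Real.exp_le_exp.2 h2
      have h4 := Real.exp_pos (-inner ℝ (-u x) (w y))
      have h5 := Real.exp_pos (inner ℝ (-u x) (w y))
      rw [Real.sinh_eq]
      linarith
    have h6 := mul_le_mul_of_nonneg_left h1 (Real.exp_pos (-(‖u x‖ ^ 2 + ‖w y‖ ^ 2) / 2)).le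
    rw [← Real.exp_add, show -(‖u x‖ ^ 2 + ‖w y‖ ^ 2) / 2 + (‖u x‖ ^ 2 + ‖w y‖ ^ 2) / 2 = 0 by
      ring, Real.exp_zero] at h6
    linarith
  · rw [huw, signMatrix_apply, hf]
    have : 0 ≤ Real.exp (-(‖u x‖ ^ 2 + ‖w y‖ ^ 2) / 2) * Real.sinh (√r)⁻¹ :=
      mul_nonneg (Real.exp_pos _).le (le_trans (by positivity) hself)
    simp only [if_true, mul_one]
    linarith
  · rw [huw, signMatrix_apply, hf]
    have h1 : Real.exp (-1) * (√r)⁻¹ ≤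
        Real.exp (-(‖u x‖ ^ 2 + ‖w y‖ ^ 2) / 2) * Real.sinh (√r)⁻¹ :=
      mul_le_mul (hδ x y) hself (by positivity) (Real.exp_pos _).le
    have h2 := Real.add_one_le_exp (-(Real.exp (-1) / √r))
    simp only [Bool.false_eq_true, if_false, mul_neg, mul_one, Real.sinh_neg]
    rw [div_eq_mul_inv (Real.exp (-1))] at h2 ⊢
    linarith

/-- A sign matrix of rank at most `r` has a monochromatic rectangle of density
`2 ^ (-O(√r log r))`. -/
theorem exists_monochromatic_rectangle [Nonempty X] [Nonempty Y] (f : X → Y → Bool) {r N : ℕ}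
    (hr : 1 ≤ r) (hrank : (signMatrix f).rank ≤ r)
    (hN : Real.exp 1 * √r * Real.log (8 * r) ≤ N) :
    ∃ (A : Finset X) (B : Finset Y) (c : Bool), (∀ x ∈ A, ∀ y ∈ B, f x y = c) ∧
      Fintype.card X * Fintype.card Y ≤ 32 * 4 ^ N * (A.card * B.card) := by
  classical
  let Q : (X → Y → Bool) → Finset X → Finset Y → ℕ := fun f S T =>
    ((S ×ˢ T).filter fun p => f p.1 p.2 = false).card
  -- negating `f` exchanges the two values and preserves the bound on the rank
  wlog hmaj : 2 * Q f Finset.univ Finset.univ ≤ Fintype.card X * Fintype.card Y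
    generalizing f with H
  · obtain ⟨A, B, c, hc, hcard⟩ := H (fun x y => !f x y)
      ((rank_signMatrix_not f).trans hrank) (by
        have := Finset.card_filter_add_card_filter_not
          (s := (Finset.univ ×ˢ Finset.univ : Finset (X × Y))) fun p => f p.1 p.2 = false
        simp only [Finset.card_product, Finset.card_univ, Bool.not_eq_false] at this
        simp only [Q, Bool.not_eq_false'] at hmaj ⊢
        omega)
    exact ⟨A, B, !c, fun x hx y hy => by rw [← hc x hx y hy, Bool.not_not], hcard⟩
  obtain ⟨K, hK, hK0, hKt, hKf⟩ := exists_isRectAverage_of_rank_le f hr hrank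
  have hr' : (0 : ℝ) < r := by exact_mod_cast hr
  have hsq : (0 : ℝ) < √r := Real.sqrt_pos.2 hr'
  let W : X → Y → ℝ := fun x y => 1 - (4 * r + 1) * if f x y = false then 1 else 0
  have hW : ∀ (c : ℝ) (S : Finset X) (T : Finset Y),
      ∑ x ∈ S, ∑ y ∈ T, (1 - c * if f x y = false then 1 else 0) =
        S.card * T.card - c * Q f S T := by
    intro c S T
    rw [← Finset.sum_product', Finset.sum_sub_distrib, ← Finset.mul_sum, Finset.sum_boole]
    simp [Q]
  -- the power `N` is chosen so that the entries `-1` are damped by the factor `1 / (8 r)`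
  have hdamp : Real.exp (-(Real.exp (-1) / √r)) ^ N ≤ 1 / (8 * r) := by
    rw [← Real.exp_nat_mul]
    have h1 : Real.log (8 * r) ≤ N * (Real.exp (-1) / √r) := by
      have h2 := mul_le_mul_of_nonneg_right hN
        (show 0 ≤ Real.exp (-1) / √r by positivity)
      refine le_trans (le_of_eq ?_) h2
      rw [Real.exp_neg]
      field_simp
    calc Real.exp (N * -(Real.exp (-1) / √r)) ≤ Real.exp (-Real.log (8 * r)) := by
          refine Real.exp_le_exp.2 ?_
          linarith
      _ = 1 / (8 * r) := by rw [Real.exp_neg, Real.exp_log (by positivity), one_div]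
  have hentry : ∀ x y, (1 / 4 : ℝ) ^ N * (1 - 3 / 2 * if f x y = false then 1 else 0) ≤
      W x y * K x y ^ N := by
    intro x y
    cases hf : f x y
    · have h1 : K x y ^ N ≤ 1 / (8 * r) * (1 / 4) ^ N := by
        calc K x y ^ N ≤ (Real.exp (-(Real.exp (-1) / √r)) / 4) ^ N :=
              pow_le_pow_left₀ (hK0 x y) (hKf x y hf) N
          _ = Real.exp (-(Real.exp (-1) / √r)) ^ N * (1 / 4) ^ N := by
              rw [← mul_pow]
              ring
          _ ≤ _ := by gcongr
      have h2 := mul_le_mul_of_nonneg_left h1 (show (0 : ℝ) ≤ 4 * r by positivity)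
      have h3 : (4 * r : ℝ) * (1 / (8 * r) * (1 / 4) ^ N) = (1 / 4) ^ N / 2 := by
        field_simp
        norm_num
      simp only [W, hf, if_true]
      linarith
    · have h1 : (1 / 4 : ℝ) ^ N ≤ K x y ^ N := pow_le_pow_left₀ (by norm_num) (hKt x y hf) N
      simpa [W, hf] using h1
  obtain ⟨S, T, hST⟩ := hK.pow N W
  have hlow : (1 / 4 : ℝ) ^ N * ((Fintype.card X * Fintype.card Y) / 4) ≤
      S.card * T.card - (4 * r + 1) * Q f S T := by
    rw [← hW]
    refine le_trans ?_ hST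
    refine le_trans ?_ (Finset.sum_le_sum fun x _ => Finset.sum_le_sum fun y _ => hentry x y)
    simp only [← Finset.mul_sum]
    rw [hW]
    have : (2 * Q f Finset.univ Finset.univ : ℝ) ≤ Fintype.card X * Fintype.card Y := by
      exact_mod_cast hmaj
    rw [Finset.card_univ, Finset.card_univ]
    refine mul_le_mul_of_nonneg_left ?_ (by positivity)
    linarith
  have hXY : (0 : ℝ) < (1 / 4 : ℝ) ^ N * ((Fintype.card X * Fintype.card Y) / 4) := by
    have h1 : (0 : ℝ) < Fintype.card X := by exact_mod_cast Fintype.card_pos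
    have h2 : (0 : ℝ) < Fintype.card Y := by exact_mod_cast Fintype.card_pos
    positivity
  have hQ0 : (0 : ℝ) ≤ Q f S T := by positivity
  have hrQ : 0 ≤ (r : ℝ) * Q f S T := by positivity
  have hT : T.Nonempty := by
    by_contra hT
    rw [Finset.not_nonempty_iff_eq_empty] at hT
    have : (T.card : ℝ) = 0 := by simp [hT]
    rw [this] at hlow
    nlinarith
  have hfew : 4 * r * Q f S T ≤ S.card * T.card := by
    have : (4 * r * Q f S T : ℝ) ≤ S.card * T.card := by nlinarith
    exact_mod_cast this
  obtain ⟨A, B, c, hc, hcard⟩ := exists_monochromatic_of_card_false_le f hr hrank S T hT hfew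
  refine ⟨A, B, c, hc, ?_⟩
  have h1 : (S.card * T.card : ℝ) ≤ 8 * (A.card * B.card) := by exact_mod_cast hcard
  have h2 : (1 / 4 : ℝ) ^ N * ((Fintype.card X * Fintype.card Y) / 4) ≤
      8 * (A.card * B.card) := by nlinarith
  have h3 : (Fintype.card X * Fintype.card Y : ℝ) ≤ 32 * 4 ^ N * (A.card * B.card) := by
    have h4 := mul_le_mul_of_nonneg_left h2 (show (0 : ℝ) ≤ 4 * 4 ^ N by positivity)
    have h5 : (4 * 4 ^ N : ℝ) * ((1 / 4 : ℝ) ^ N * ((Fintype.card X * Fintype.card Y) / 4)) =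
        Fintype.card X * Fintype.card Y := by
      rw [one_div, inv_pow]
      field_simp
    linarith
  exact_mod_cast h3

end MonochromaticRectangle

/-! ### Announcing a number -/

section Announce

variable {X Y : Type*}

/-- The row player announces a number below `2 ^ k` with `k` bits. -/
theorem exists_protocol_rowAnnounces (k : ℕ) {c : ℕ} (P : ℕ → Protocol X Y)
    (hP : ∀ i, (P i).cost ≤ c) (α : X → ℕ) :
    ∃ Q : Protocol X Y, Q.cost ≤ k + c ∧
      ∀ x y, α x < 2 ^ k → Q.run x y = (P (α x)).run x y := by
  induction k generalizing P α with
  | zero => exact ⟨P 0, by simpa using hP 0, fun x y h => by rw [Nat.lt_one_iff.1 h]⟩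
  | succ k ih =>
    obtain ⟨Q₁, h₁, hrun₁⟩ := ih P hP α
    obtain ⟨Q₀, h₀, hrun₀⟩ := ih (fun i => P (2 ^ k + i)) (fun i => hP _) (fun x => α x - 2 ^ k)
    refine ⟨.rowSends (fun x => decide (α x < 2 ^ k)) Q₁ Q₀, ?_, fun x y h => ?_⟩
    · simp only [Protocol.cost]
      omega
    · rw [pow_succ] at h
      by_cases hx : α x < 2 ^ k
      · simp [Protocol.run, hx, hrun₁ x y hx]
      · rw [not_lt] at hx
        simp [Protocol.run, hx, hrun₀ x y (by omega), Nat.add_sub_cancel' hx]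

/-- The column player announces a number below `2 ^ k` with `k` bits. -/
theorem exists_protocol_colAnnounces (k : ℕ) {c : ℕ} (P : ℕ → Protocol X Y)
    (hP : ∀ i, (P i).cost ≤ c) (β : Y → ℕ) :
    ∃ Q : Protocol X Y, Q.cost ≤ k + c ∧
      ∀ x y, β y < 2 ^ k → Q.run x y = (P (β y)).run x y := by
  induction k generalizing P β with
  | zero => exact ⟨P 0, by simpa using hP 0, fun x y h => by rw [Nat.lt_one_iff.1 h]⟩
  | succ k ih =>
    obtain ⟨Q₁, h₁, hrun₁⟩ := ih P hP β
    obtain ⟨Q₀, h₀, hrun₀⟩ := ih (fun i => P (2 ^ k + i)) (fun i => hP _) (fun y => β y - 2 ^ k)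
    refine ⟨.colSends (fun y => decide (β y < 2 ^ k)) Q₁ Q₀, ?_, fun x y h => ?_⟩
    · simp only [Protocol.cost]
      omega
    · rw [pow_succ] at h
      by_cases hy : β y < 2 ^ k
      · simp [Protocol.run, hy, hrun₁ x y hy]
      · rw [not_lt] at hy
        simp [Protocol.run, hy, hrun₀ x y (by omega), Nat.add_sub_cancel' hy]

end Announce

/-! ### Ranks of rectangles and peeling -/

section RectRank

variable {X Y : Type*}

/-- The rank of the sign matrix of `f` restricted to the rectangle `S × T`. -/
noncomputable def rectRank (f : X → Y → Bool) (S : Finset X) (T : Finset Y) : ℕ :=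
  ((signMatrix f).submatrix (fun x : S => x.1) (fun y : T => y.1)).rank

theorem rectRank_univ [Fintype X] [Fintype Y] (f : X → Y → Bool) :
    rectRank f Finset.univ Finset.univ ≤ (signMatrix f).rank :=
  rank_submatrix_le _ _ _

theorem rectRank_le_of_map {f : X → Y → Bool} {S₁ S₂ : Finset X} {T₁ T₂ : Finset Y}
    (π : X → X) (σ : Y → Y) (hπ : ∀ x ∈ S₁, π x ∈ S₂) (hσ : ∀ y ∈ T₁, σ y ∈ T₂)
    (hf : ∀ x ∈ S₁, ∀ y ∈ T₁, f x y = f (π x) (σ y)) :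
    rectRank f S₁ T₁ ≤ rectRank f S₂ T₂ := by
  refine le_trans (le_of_eq ?_) (rank_submatrix_le
    ((signMatrix f).submatrix (fun x : S₂ => x.1) (fun y : T₂ => y.1))
    (fun x : S₁ => ⟨π x, hπ x x.2⟩) (fun y : T₁ => ⟨σ y, hσ y y.2⟩))
  rw [rectRank]
  congr 1
  ext x y
  exact signMatrix_eq_iff.2 (hf x x.2 y y.2)

theorem rectRank_mono {f : X → Y → Bool} {S₁ S₂ : Finset X} {T₁ T₂ : Finset Y} (hS : S₁ ⊆ S₂)
    (hT : T₁ ⊆ T₂) : rectRank f S₁ T₁ ≤ rectRank f S₂ T₂ :=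
  rectRank_le_of_map id id (fun _ h => hS h) (fun _ h => hT h) fun _ _ _ _ => rfl

theorem rectRank_flip (f : X → Y → Bool) (S : Finset X) (T : Finset Y) :
    rectRank (fun y x => f x y) T S = rectRank f S T := by
  rw [rectRank, rectRank, ← rank_transpose]
  rfl

theorem rectRank_empty_left (f : X → Y → Bool) (T : Finset Y) : rectRank f ∅ T = 0 := by
  have := rank_le_card_height
    ((signMatrix f).submatrix (fun x : (∅ : Finset X) => x.1) (fun y : T => y.1))
  exact Nat.le_zero.1 (this.trans (by simp))

theorem rectRank_empty_right (f : X → Y → Bool) (S : Finset X) : rectRank f S ∅ = 0 := by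
  rw [← rectRank_flip, rectRank_empty_left]

theorem rectRank_add_rectRank_le {f : X → Y → Bool} {S A : Finset X} {T B : Finset Y} {c : Bool}
    (hA : A ⊆ S) (hB : B ⊆ T) (hc : ∀ x ∈ A, ∀ y ∈ B, f x y = c) :
    rectRank f A T + rectRank f S B ≤ rectRank f S T + 1 := by
  refine rank_submatrix_add_rank_submatrix_le
    ((signMatrix f).submatrix (fun x : S => x.1) (fun y : T => y.1))
    (fun x : A => ⟨x, hA x.2⟩) (fun y : B => ⟨y, hB y.2⟩) (if c then 1 else -1) fun x y => ?_
  rw [submatrix_apply, signMatrix_apply, hc x x.2 y y.2]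

/-- A rectangle of rank `r` has at most `2 ^ r` distinct rows: a row is determined by its entries
in `r` columns that span the others. -/
theorem exists_row_representatives {f : X → Y → Bool} {S : Finset X} {T : Finset Y} {r : ℕ}
    (hr : rectRank f S T ≤ r) :
    ∃ (S' : Finset X) (π : X → X), S' ⊆ S ∧ S'.card ≤ 2 ^ r ∧
      ∀ x ∈ S, π x ∈ S' ∧ ∀ y ∈ T, f x y = f (π x) y := by
  classical
  rcases S.eq_empty_or_nonempty with rfl | ⟨x₀, hx₀⟩
  · exact ⟨∅, id, by simp, by simp, by simp⟩
  have : Nonempty X := ⟨x₀⟩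
  obtain ⟨b, -, hspan⟩ := exists_linearIndependent_rows
    ((signMatrix f).submatrix (fun x : S => x.1) (fun y : T => y.1))ᵀ
  rw [← rectRank_flip] at hr
  let p : X → Fin _ → Bool := fun x i => f x (b i).1
  have hp : ∀ x ∈ S, ∀ x' ∈ S, p x = p x' → ∀ y ∈ T, f x y = f x' y := by
    intro x hx x' hx' hpx y hy
    let φ : (S → ℝ) →ₗ[ℝ] ℝ := LinearMap.proj (R := ℝ) (φ := fun _ => ℝ) ⟨x, hx⟩ -
      LinearMap.proj (R := ℝ) (φ := fun _ => ℝ) ⟨x', hx'⟩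
    have hle : Submodule.span ℝ (Set.range fun i =>
        ((signMatrix f).submatrix (fun x : S => x.1) (fun y : T => y.1))ᵀ (b i)) ≤
        LinearMap.ker φ := by
      rw [Submodule.span_le]
      rintro _ ⟨i, rfl⟩
      have h1 : f x (b i).1 = f x' (b i).1 := congrFun hpx i
      simp [φ, signMatrix_apply, h1]
    have h0 := hle (hspan ⟨y, hy⟩)
    have h1 : signMatrix f x y = signMatrix f x' y := sub_eq_zero.1 h0
    exact signMatrix_eq_iff.1 h1
  let q := Function.invFunOn p (S : Set X)
  have hq : ∀ x ∈ S, q (p x) ∈ S ∧ p (q (p x)) = p x := fun x hx =>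
    have : ∃ a ∈ (S : Set X), p a = p x := ⟨x, hx, rfl⟩
    ⟨Function.invFunOn_mem this, Function.invFunOn_eq this⟩
  refine ⟨(S.image p).image q, fun x => q (p x), ?_, ?_, fun x hx => ⟨?_, ?_⟩⟩
  · intro z hz
    obtain ⟨_, hw, rfl⟩ := Finset.mem_image.1 hz
    obtain ⟨x, hx, rfl⟩ := Finset.mem_image.1 hw
    exact (hq x hx).1
  · calc ((S.image p).image q).card ≤ (S.image p).card := Finset.card_image_le
      _ ≤ Fintype.card (Fin _ → Bool) := Finset.card_le_univ _
      _ = 2 ^ rectRank (fun y x => f x y) T S := by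
        rw [Fintype.card_fun, Fintype.card_bool, Fintype.card_fin]
        rfl
      _ ≤ 2 ^ r := Nat.pow_le_pow_right (by norm_num) hr
  · exact Finset.mem_image_of_mem _ (Finset.mem_image_of_mem _ hx)
  · exact hp x hx _ (hq x hx).1 (hq x hx).2.symm

theorem exists_monochromatic_subrectangle {f : X → Y → Bool} {S : Finset X} {T : Finset Y}
    (hS : S.Nonempty) (hT : T.Nonempty) {r N : ℕ} (hr : 1 ≤ r) (hrank : rectRank f S T ≤ r)
    (hN : Real.exp 1 * √r * Real.log (8 * r) ≤ N) :
    ∃ (A : Finset X) (B : Finset Y) (c : Bool), A ⊆ S ∧ B ⊆ T ∧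
      (∀ x ∈ A, ∀ y ∈ B, f x y = c) ∧ S.card * T.card ≤ 32 * 4 ^ N * (A.card * B.card) := by
  have := hS.to_subtype
  have := hT.to_subtype
  obtain ⟨A, B, c, hc, hcard⟩ :=
    exists_monochromatic_rectangle (fun (x : S) (y : T) => f x y) hr hrank hN
  refine ⟨A.map (.subtype _), B.map (.subtype _), c, ?_, ?_, ?_, by simpa using hcard⟩
  · exact fun x hx => Finset.property_of_mem_map_subtype A hx
  · exact fun y hy => Finset.property_of_mem_map_subtype B hy
  · intro x hx y hy
    obtain ⟨x', hx', rfl⟩ := Finset.mem_map.1 hx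
    obtain ⟨y', hy', rfl⟩ := Finset.mem_map.1 hy
    exact hc x' hx' y' hy'

/-- Peeling: while the rectangle is not empty, a dense monochromatic block `A × B` is found and
either its rows or its columns, whichever have rank at most half, are split off. The numbers
`α x` and `β y` say how many row blocks, respectively column blocks, have been split off before
`x`, respectively `y`, is. -/
theorem exists_peeling {f : X → Y → Bool} {r r' D : ℕ} (hr' : r ≤ 2 * r')
    (H : ∀ (S : Finset X) (T : Finset Y), S.Nonempty → T.Nonempty → rectRank f S T ≤ r →
      ∃ (A : Finset X) (B : Finset Y) (c : Bool), A ⊆ S ∧ B ⊆ T ∧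
        (∀ x ∈ A, ∀ y ∈ B, f x y = c) ∧ S.card * T.card ≤ D * (A.card * B.card)) (hD : 1 ≤ D)
    (t : ℕ) (S : Finset X) (T : Finset Y) (hrank : rectRank f S T ≤ r)
    (hsize : (S.card * T.card : ℝ) * (1 - 1 / D) ^ t < 1) :
    ∃ (α : X → ℕ) (β : Y → ℕ), (∀ x, α x ≤ t) ∧ (∀ y, β y ≤ t) ∧
      ∀ i j, rectRank f {x ∈ S | α x = i} {y ∈ T | β y = j} ≤ r' := by
  classical
  have hD0 : (1 : ℝ) ≤ D := by exact_mod_cast hD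
  have hq : (0 : ℝ) ≤ 1 - 1 / D := by
    rw [sub_nonneg, div_le_one (by linarith)]
    exact hD0
  have hempty : ∀ (t : ℕ) (S : Finset X) (T : Finset Y), S = ∅ ∨ T = ∅ →
      ∃ (α : X → ℕ) (β : Y → ℕ), (∀ x, α x ≤ t) ∧ (∀ y, β y ≤ t) ∧
      ∀ i j, rectRank f {x ∈ S | α x = i} {y ∈ T | β y = j} ≤ r' := by
    intro t S T h
    refine ⟨fun _ => 0, fun _ => 0, by simp, by simp, fun i j => ?_⟩
    rcases h with rfl | rfl
    · rw [Finset.filter_empty, rectRank_empty_left]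
      exact Nat.zero_le _
    · rw [Finset.filter_empty, rectRank_empty_right]
      exact Nat.zero_le _
  induction t generalizing S T with
  | zero =>
    refine hempty 0 S T ?_
    rw [pow_zero, mul_one] at hsize
    have : S.card * T.card < 1 := by exact_mod_cast hsize
    simpa using this
  | succ t ih =>
    rcases S.eq_empty_or_nonempty with hS | hS
    · exact hempty _ S T (Or.inl hS)
    rcases T.eq_empty_or_nonempty with hT | hT
    · exact hempty _ S T (Or.inr hT)
    obtain ⟨A, B, c, hA, hB, hc, hcard⟩ := H S T hS hT hrank
    have hAB : (S.card * T.card : ℝ) * (1 / D) ≤ A.card * B.card := by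
      rw [mul_one_div, div_le_iff₀ (by linarith), mul_comm _ (D : ℝ)]
      exact_mod_cast hcard
    have hAS : (A.card : ℝ) ≤ S.card := by exact_mod_cast Finset.card_le_card hA
    have hBT : (B.card : ℝ) ≤ T.card := by exact_mod_cast Finset.card_le_card hB
    have hB0 : (0 : ℝ) ≤ B.card := by positivity
    have hA0 : (0 : ℝ) ≤ A.card := by positivity
    have hshrink : ∀ s : ℝ, s ≤ S.card * T.card - A.card * B.card →
        s * (1 - 1 / D) ^ t < 1 := by
      intro s hs
      refine lt_of_le_of_lt ?_ hsize
      rw [pow_succ', ← mul_assoc]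
      refine mul_le_mul_of_nonneg_right ?_ (pow_nonneg hq _)
      linarith
    have hsum := rectRank_add_rectRank_le hA hB hc
    rcases le_or_gt (rectRank f A T) r' with hlow | hlow
    · obtain ⟨α, β, hα, hβ, hαβ⟩ := ih (S \ A) T
        ((rectRank_mono Finset.sdiff_subset subset_rfl).trans hrank) (hshrink _ (by
          rw [Finset.cast_card_sdiff hA]
          nlinarith))
      refine ⟨fun x => if x ∈ A then 0 else α x + 1, β, fun x => ?_,
        fun y => (hβ y).trans t.le_succ, fun i j => ?_⟩
      · dsimp only
        split_ifs
        · exact Nat.zero_le _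
        · exact Nat.succ_le_succ (hα x)
      · cases i with
        | zero =>
          refine le_trans (rectRank_mono ?_ (Finset.filter_subset _ _)) hlow
          intro x hx
          by_contra hxA
          simpa [hxA] using (Finset.mem_filter.1 hx).2
        | succ i =>
          refine le_trans (rectRank_mono ?_ subset_rfl) (hαβ i j)
          intro x hx
          obtain ⟨hxS, hx⟩ := Finset.mem_filter.1 hx
          by_cases hxA : x ∈ A
          · simp [hxA] at hx
          · exact Finset.mem_filter.2 ⟨Finset.mem_sdiff.2 ⟨hxS, hxA⟩, by simpa [hxA] using hx⟩
    · have hlow' : rectRank f S B ≤ r' := by omega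
      obtain ⟨α, β, hα, hβ, hαβ⟩ := ih S (T \ B)
        ((rectRank_mono subset_rfl Finset.sdiff_subset).trans hrank) (hshrink _ (by
          rw [Finset.cast_card_sdiff hB]
          nlinarith))
      refine ⟨α, fun y => if y ∈ B then 0 else β y + 1,
        fun x => (hα x).trans t.le_succ, fun y => ?_, fun i j => ?_⟩
      · dsimp only
        split_ifs
        · exact Nat.zero_le _
        · exact Nat.succ_le_succ (hβ y)
      · cases j with
        | zero =>
          refine le_trans (rectRank_mono (Finset.filter_subset _ _) ?_) hlow'
          intro y hy
          by_contra hyB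
          simpa [hyB] using (Finset.mem_filter.1 hy).2
        | succ j =>
          refine le_trans (rectRank_mono subset_rfl ?_) (hαβ i j)
          intro y hy
          obtain ⟨hyT, hy⟩ := Finset.mem_filter.1 hy
          by_cases hyB : y ∈ B
          · simp [hyB] at hy
          · exact Finset.mem_filter.2 ⟨Finset.mem_sdiff.2 ⟨hyT, hyB⟩, by simpa [hyB] using hy⟩

end RectRank

/-! ### The protocol -/

section Recursion

variable {X Y : Type*}

theorem exists_protocol_of_rectRank_le_one {f : X → Y → Bool} {S : Finset X} {T : Finset Y}
    (hr : rectRank f S T ≤ 1) :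
    ∃ P : Protocol X Y, P.cost ≤ 2 ∧ ∀ x ∈ S, ∀ y ∈ T, P.run x y = f x y := by
  classical
  obtain ⟨S', π, -, hcard, hπ⟩ := exists_row_representatives hr
  let α : X → ℕ := fun x => if h : π x ∈ S' then S'.equivFin ⟨π x, h⟩ else 0
  let P : ℕ → Protocol X Y := fun i =>
    .colSends (fun y => if h : i < S'.card then f (S'.equivFin.symm ⟨i, h⟩).1 y else false)
      (.output true) (.output false)
  obtain ⟨Q, hQ, hrun⟩ := exists_protocol_rowAnnounces 1 P (c := 1)
    (fun i => by simp [P, Protocol.cost]) α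
  refine ⟨Q, hQ, fun x hx y hy => ?_⟩
  obtain ⟨hxS, hxf⟩ := hπ x hx
  have hα : α x = S'.equivFin ⟨π x, hxS⟩ := by simp only [α, hxS, dif_pos]
  rw [hrun x y (by rw [hα]; exact (Fin.is_lt _).trans_le hcard), hxf y hy]
  simp only [P, Protocol.run, hα, Fin.is_lt, dif_pos, Fin.eta, Equiv.symm_apply_apply]
  cases f (π x) y <;> simp

/-- One phase: two announcements of `k` bits lead to a rectangle of rank at most
`(r + 1) / 2`. As there are at
most `2 ^ r` distinct rows and columns, `2 r D` peeling steps, where `1 / D` is the density of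
the monochromatic blocks, exhaust the rectangle. -/
theorem exists_protocol_of_half_rank {f : X → Y → Bool} {r N k c : ℕ} (hr : 1 ≤ r)
    (hN : Real.exp 1 * √r * Real.log (8 * r) ≤ N) (hk : 2 * r * (32 * 4 ^ N) < 2 ^ k)
    (ih : ∀ (S : Finset X) (T : Finset Y), rectRank f S T ≤ (r + 1) / 2 →
      ∃ P : Protocol X Y, P.cost ≤ c ∧ ∀ x ∈ S, ∀ y ∈ T, P.run x y = f x y)
    {S : Finset X} {T : Finset Y} (hrank : rectRank f S T ≤ r) :
    ∃ P : Protocol X Y, P.cost ≤ k + (k + c) ∧ ∀ x ∈ S, ∀ y ∈ T, P.run x y = f x y := by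
  classical
  obtain ⟨S', π, hS', hScard, hπ⟩ := exists_row_representatives hrank
  have hrank' : rectRank (fun y x => f x y) T S' ≤ r := by
    rw [rectRank_flip]
    exact (rectRank_mono hS' subset_rfl).trans hrank
  obtain ⟨T', σ, hT', hTcard, hσ⟩ := exists_row_representatives hrank'
  have hf : ∀ x ∈ S, ∀ y ∈ T, f x y = f (π x) (σ y) := fun x hx y hy => by
    rw [(hπ x hx).2 y hy, (hσ y hy).2 (π x) (hπ x hx).1]
  set D := 32 * 4 ^ N with hD
  have hD1 : 1 ≤ D := Nat.one_le_iff_ne_zero.2 (by positivity)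
  have hDpos : (0 : ℝ) < D := by exact_mod_cast hD1
  have hsize : (S'.card * T'.card : ℝ) * (1 - 1 / D) ^ (2 * r * D) < 1 := by
    have h1 : (S'.card * T'.card : ℝ) ≤ 2 ^ r * 2 ^ r := by
      exact_mod_cast Nat.mul_le_mul hScard hTcard
    have h2 : (1 - 1 / D : ℝ) ^ (2 * r * D) ≤ Real.exp (-1) ^ (2 * r) := by
      have h3 : (1 - 1 / D : ℝ) ^ D ≤ Real.exp (-1) := by
        refine (pow_le_pow_left₀ ?_ (Real.one_sub_le_exp_neg _) D).trans ?_
        · rw [sub_nonneg, div_le_one hDpos]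
          exact_mod_cast hD1
        · rw [← Real.exp_nat_mul]
          field_simp
          rfl
      rw [mul_comm, pow_mul]
      refine pow_le_pow_left₀ (pow_nonneg ?_ _) h3 _
      rw [sub_nonneg, div_le_one hDpos]
      exact_mod_cast hD1
    have h4 : 2 * Real.exp (-1) < 1 := by
      have := Real.exp_one_gt_d9
      rw [Real.exp_neg, ← div_eq_mul_inv, div_lt_one (Real.exp_pos _)]
      linarith
    calc (S'.card * T'.card : ℝ) * (1 - 1 / D) ^ (2 * r * D)
        ≤ (2 ^ r * 2 ^ r) * Real.exp (-1) ^ (2 * r) := by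
          refine mul_le_mul h1 h2 (pow_nonneg ?_ _) (by positivity)
          rw [sub_nonneg, div_le_one hDpos]
          exact_mod_cast hD1
      _ = (2 * Real.exp (-1)) ^ (2 * r) := by ring
      _ < 1 := pow_lt_one₀ (by positivity) h4 (by omega)
  obtain ⟨α, β, hα, hβ, hαβ⟩ := exists_peeling (f := f) (r := r) (r' := (r + 1) / 2) (by omega)
    (fun S T hS hT h => exists_monochromatic_subrectangle hS hT hr h hN) hD1 (2 * r * D) S' T'
    ((rectRank_mono hS' hT').trans hrank) hsize
  have hP : ∀ i j, ∃ P : Protocol X Y, P.cost ≤ c ∧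
      ∀ x ∈ S.filter (fun x => α (π x) = i), ∀ y ∈ T.filter (fun y => β (σ y) = j),
        P.run x y = f x y := by
    intro i j
    refine ih _ _ ((rectRank_le_of_map π σ ?_ ?_ ?_).trans (hαβ i j))
    · intro x hx
      obtain ⟨hx, hxi⟩ := Finset.mem_filter.1 hx
      exact Finset.mem_filter.2 ⟨(hπ x hx).1, hxi⟩
    · intro y hy
      obtain ⟨hy, hyj⟩ := Finset.mem_filter.1 hy
      exact Finset.mem_filter.2 ⟨(hσ y hy).1, hyj⟩
    · exact fun x hx y hy => hf x (Finset.mem_filter.1 hx).1 y (Finset.mem_filter.1 hy).1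
  choose P hPcost hPrun using hP
  have hQ := fun i => exists_protocol_colAnnounces k (P i) (hPcost i) (fun y => β (σ y))
  choose Q hQcost hQrun using hQ
  obtain ⟨R, hR, hRrun⟩ := exists_protocol_rowAnnounces k Q hQcost (fun x => α (π x))
  refine ⟨R, hR, fun x hx y hy => ?_⟩
  rw [hRrun x y ((hα _).trans_lt hk), hQrun _ x y ((hβ _).trans_lt hk)]
  exact hPrun _ _ x (Finset.mem_filter.2 ⟨hx, rfl⟩) y (Finset.mem_filter.2 ⟨hy, rfl⟩)

/-- The lengths of the two announcements of a phase are `O(√r log r)`. -/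
theorem exists_phase_parameters {r : ℕ} (hr : 1 ≤ r) :
    ∃ N k : ℕ, Real.exp 1 * √r * Real.log (8 * r) ≤ N ∧ 2 * r * (32 * 4 ^ N) < 2 ^ k ∧
      (k : ℝ) ≤ 19 * (√r * Real.log (8 * r)) := by
  have hr' : (1 : ℝ) ≤ r := by exact_mod_cast hr
  have hsq : 1 ≤ √(r : ℝ) := Real.one_le_sqrt.2 hr'
  have hlog2 := Real.log_two_gt_d9
  have hlog2' := Real.log_two_lt_d9
  have hℓ : 2 ≤ Real.log (8 * r) := by
    have h1 : Real.log 8 = 3 * Real.log 2 := by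
      rw [show (8 : ℝ) = 2 ^ 3 by norm_num, Real.log_pow]
      norm_num
    have h2 : Real.log 8 ≤ Real.log (8 * r) := Real.log_le_log (by norm_num) (by linarith)
    linarith
  set ℓ := Real.log (8 * r) with hℓdef
  have hs : ℓ ≤ √r * ℓ := le_mul_of_one_le_left (by linarith) hsq
  set s := √r * ℓ with hsdef
  let N := ⌈Real.exp 1 * √r * ℓ⌉₊
  have hNle : (N : ℝ) ≤ Real.exp 1 * s + 1 := by
    have := Nat.ceil_lt_add_one (show 0 ≤ Real.exp 1 * √r * ℓ by positivity)
    rw [mul_assoc] at this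
    simpa only [N, mul_assoc] using this.le
  have hexp := Real.exp_one_lt_d9
  have hes : Real.exp 1 * s ≤ 2.72 * s := mul_le_mul_of_nonneg_right (by linarith) (by linarith)
  refine ⟨N, ⌊18 * s⌋₊ + 1, Nat.le_ceil _, ?_, ?_⟩
  · have hpos : (0 : ℝ) < 2 * r * (32 * 4 ^ N) := by positivity
    have hlog : Real.log (2 * r * (32 * 4 ^ N)) = ℓ + (3 + 2 * N) * Real.log 2 := by
      rw [show (2 * r * (32 * 4 ^ N) : ℝ) = (8 * r) * 2 ^ (3 + 2 * N) by
        rw [pow_add, pow_mul]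
        norm_num
        ring, Real.log_mul (by positivity) (by positivity), Real.log_pow]
      push_cast
      ring
    have hfl : 18 * s < (⌊18 * s⌋₊ : ℝ) + 1 := Nat.lt_floor_add_one _
    have h1 : Real.log (2 * r * (32 * 4 ^ N)) <
        Real.log (2 ^ (⌊18 * s⌋₊ + 1)) := by
      rw [hlog, Real.log_pow]
      push_cast
      have h2 : 18 * s * Real.log 2 ≤ ((⌊18 * s⌋₊ : ℝ) + 1) * Real.log 2 :=
        mul_le_mul_of_nonneg_right hfl.le (by linarith)
      refine lt_of_lt_of_le ?_ h2
      have h3 : (3 + 2 * N : ℝ) ≤ 5 + 5.44 * s := by linarith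
      have h4 : ℓ ≤ 1.5 * s * Real.log 2 := by nlinarith
      have h5 : (3 + 2 * N : ℝ) * Real.log 2 ≤ (5 + 5.44 * s) * Real.log 2 :=
        mul_le_mul_of_nonneg_right h3 (by linarith)
      have h6 : 0 < (11.06 * s - 5) * Real.log 2 := mul_pos (by linarith) (by linarith)
      linarith
    have h2 := (Real.log_lt_log_iff hpos (by positivity)).1 h1
    exact_mod_cast h2
  · have := Nat.floor_le (show 0 ≤ 18 * s by linarith)
    push_cast
    linarith

/-- The lengths of the phases form a geometric series, because the rank is halved in each. -/
theorem exists_protocol_of_rectRank_le (f : X → Y → Bool) {r : ℕ} (hr : 1 ≤ r) (S : Finset X)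
    (T : Finset Y) (hrank : rectRank f S T ≤ r) :
    ∃ P : Protocol X Y, (P.cost : ℝ) ≤ 300 * (√r * Real.log (8 * r)) ∧
      ∀ x ∈ S, ∀ y ∈ T, P.run x y = f x y := by
  induction r using Nat.strong_induction_on generalizing S T with
  | _ r IH =>
  have hℓ : ∀ q : ℕ, 1 ≤ q → 0 ≤ Real.log (8 * q) := fun q hq => by
    have : (1 : ℝ) ≤ q := by exact_mod_cast hq
    exact Real.log_nonneg (by linarith)
  obtain ⟨N, k, hN, hk, hkle⟩ := exists_phase_parameters hr
  rcases hr.eq_or_lt with rfl | hr2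
  · obtain ⟨P, hP, hrun⟩ := exists_protocol_of_rectRank_le_one hrank
    refine ⟨P, ?_, hrun⟩
    have hP' : (P.cost : ℝ) ≤ 2 := by exact_mod_cast hP
    have hk1 : 1 ≤ k := by
      rcases Nat.eq_zero_or_pos k with rfl | h
      · have : 0 < 4 ^ N := by positivity
        omega
      · exact h
    have : (1 : ℝ) ≤ k := by exact_mod_cast hk1
    linarith
  · set q := (r + 1) / 2 with hq
    have hq1 : 1 ≤ q := by omega
    have hqr : q < r := by omega
    obtain ⟨P, hP, hrun⟩ := exists_protocol_of_half_rank
      (c := ⌊300 * (√q * Real.log (8 * q))⌋₊) hr hN hk (fun S T h => by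
        obtain ⟨P, hP, hrun⟩ := IH q hqr hq1 S T h
        exact ⟨P, Nat.le_floor hP, hrun⟩) hrank
    refine ⟨P, ?_, hrun⟩
    have h1 : (P.cost : ℝ) ≤ k + (k + ⌊300 * (√q * Real.log (8 * q))⌋₊) := by exact_mod_cast hP
    have h2 := Nat.floor_le (show 0 ≤ 300 * (√q * Real.log (8 * q)) from
      mul_nonneg (by norm_num) (mul_nonneg (Real.sqrt_nonneg _) (hℓ q hq1)))
    have hr0 : (0 : ℝ) ≤ r := by positivity
    have hqr34 : (q : ℝ) ≤ 0.87 ^ 2 * r := by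
      have : (4 * q : ℝ) ≤ 3 * r := by
        have : 4 * q ≤ 3 * r := by omega
        exact_mod_cast this
      linarith
    have h3 : √(q : ℝ) ≤ 0.87 * √r := by
      refine (Real.sqrt_le_sqrt hqr34).trans (le_of_eq ?_)
      rw [Real.sqrt_mul (by norm_num), Real.sqrt_sq (by norm_num)]
    have h4 : Real.log (8 * q) ≤ Real.log (8 * r) := by
      have h5 : (0 : ℝ) < q := by exact_mod_cast hq1
      have h6 : (q : ℝ) ≤ r := by exact_mod_cast hqr.le
      exact Real.log_le_log (by linarith) (by linarith)
    have h5 : √q * Real.log (8 * q) ≤ 0.87 * √r * Real.log (8 * r) :=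
      mul_le_mul h3 h4 (hℓ q hq1) (by positivity)
    have h6 : 0 ≤ √r * Real.log (8 * r) := mul_nonneg (Real.sqrt_nonneg _) (hℓ r hr)
    linarith

theorem detCC_le_of_rank_signMatrix_le [Fintype X] [Fintype Y] (f : X → Y → Bool) {r : ℕ}
    (hr : 1 ≤ r) (hrank : (signMatrix f).rank ≤ r) :
    (detCC f : ℝ) ≤ 300 * (√r * Real.log (8 * r)) := by
  obtain ⟨P, hP, hrun⟩ := exists_protocol_of_rectRank_le f hr Finset.univ Finset.univ
    ((rectRank_univ f).trans hrank)
  refine le_trans ?_ hP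
  have : detCC f ≤ P.cost :=
    Nat.sInf_le ⟨P, fun x y => hrun x (Finset.mem_univ x) y (Finset.mem_univ y), rfl⟩
  exact_mod_cast this

end Recursion

/-! ### The two conventions for the matrix -/

section Conventions

variable {X Y : Type*} [Fintype X] [Fintype Y]

theorem rank_signMatrix_le_rank_zeroOneMatrix_add_one (f : X → Y → Bool) :
    (signMatrix f).rank ≤ (zeroOneMatrix f).rank + 1 := by
  classical
  let L := Submodule.span ℝ (Set.range (zeroOneMatrix f).row)
  let J := Submodule.span ℝ {(1 : Y → ℝ)}
  have hle : Submodule.span ℝ (Set.range (signMatrix f).row) ≤ L ⊔ J := by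
    rw [Submodule.span_le]
    rintro _ ⟨x, rfl⟩
    have : (signMatrix f).row x = (2 : ℝ) • (zeroOneMatrix f).row x + (-1 : ℝ) • (1 : Y → ℝ) := by
      ext y
      simp only [row_apply, signMatrix, zeroOneMatrix, of_apply, Pi.add_apply, Pi.smul_apply,
        Pi.one_apply, smul_eq_mul]
      split_ifs <;> norm_num
    rw [this]
    exact Submodule.add_mem_sup (Submodule.smul_mem _ _ (Submodule.subset_span ⟨x, rfl⟩))
      (Submodule.smul_mem _ _ (Submodule.mem_span_singleton_self _))
  have hJ : finrank ℝ J ≤ 1 := by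
    simpa using finrank_span_le_card (R := ℝ) ({1} : Set (Y → ℝ))
  rw [rank_eq_finrank_span_row, rank_eq_finrank_span_row]
  calc _ ≤ finrank ℝ (L ⊔ J : Submodule ℝ (Y → ℝ)) := Submodule.finrank_mono hle
    _ ≤ finrank ℝ L + finrank ℝ J := Submodule.finrank_add_le_finrank_add_finrank _ _
    _ ≤ _ := Nat.add_le_add_left hJ _

theorem detCC_le_of_rank_signMatrix_le_add_one (f : X → Y → Bool) {r : ℕ} (hr : 2 ≤ r)
    (hrank : (signMatrix f).rank ≤ r + 1) :
    (detCC f : ℝ) ≤ 3000 * (√r * Real.logb 2 r) := by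
  have hr' : (2 : ℝ) ≤ r := by exact_mod_cast hr
  refine (detCC_le_of_rank_signMatrix_le f (by omega) hrank).trans ?_
  have hlog2 := Real.log_pos one_lt_two
  have hlog2' : Real.log 2 < 1 := by linarith [Real.log_two_lt_d9]
  have h1 : √((r + 1 : ℕ) : ℝ) ≤ 2 * √r := by
    have : ((r + 1 : ℕ) : ℝ) ≤ 2 ^ 2 * r := by
      push_cast
      linarith
    refine (Real.sqrt_le_sqrt this).trans (le_of_eq ?_)
    rw [Real.sqrt_mul (by norm_num), Real.sqrt_sq (by norm_num)]
  have h2 : Real.log (8 * (r + 1 : ℕ)) ≤ 5 * Real.logb 2 r := by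
    have h3 : Real.log (8 * (r + 1 : ℕ)) ≤ Real.log (r ^ 5) := by
      refine Real.log_le_log (by positivity) ?_
      push_cast
      have h4 : (2 : ℝ) ^ 4 ≤ r ^ 4 := pow_le_pow_left₀ (by norm_num) hr' 4
      have h5 : (r : ℝ) ^ 5 = r ^ 4 * r := by ring
      nlinarith
    rw [Real.log_pow] at h3
    push_cast at h3 ⊢
    have h6 : Real.log r ≤ Real.logb 2 r := by
      rw [Real.logb, le_div_iff₀ hlog2]
      exact mul_le_of_le_one_right (Real.log_nonneg (by linarith)) hlog2'.le
    linarith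
  have h3 : 0 ≤ Real.log (8 * (r + 1 : ℕ)) := by
    refine Real.log_nonneg ?_
    push_cast
    linarith
  have h4 := mul_le_mul h1 h2 h3 (by positivity)
  linarith

end Conventions

end TwoParty

theorem theorem3 :
    ∃ C : ℝ, 0 < C ∧
      ∀ (X : Type*) (Y : Type*) [Fintype X] [Fintype Y] (f : X → Y → Bool),
        (2 ≤ (TwoParty.zeroOneMatrix f).rank →
          (TwoParty.detCC f : ℝ) ≤
            C * (Real.sqrt (TwoParty.zeroOneMatrix f).rank *
              Real.logb 2 (TwoParty.zeroOneMatrix f).rank)) ∧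
        (2 ≤ (TwoParty.signMatrix f).rank →
          (TwoParty.detCC f : ℝ) ≤
            C * (Real.sqrt (TwoParty.signMatrix f).rank *
              Real.logb 2 (TwoParty.signMatrix f).rank)) :=
  ⟨3000, by norm_num, fun _ _ _ _ f =>
    ⟨fun h => TwoParty.detCC_le_of_rank_signMatrix_le_add_one f h
      (TwoParty.rank_signMatrix_le_rank_zeroOneMatrix_add_one f),
     fun h => TwoParty.detCC_le_of_rank_signMatrix_le_add_one f h (Nat.le_succ _)⟩⟩
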